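/- A \emph{pasture} is a commutative monoid $P$ with identity $1$ and absorbing element $0$ such that $P^\times=P\setminus\{0\}$ is an abelian group, together with a nullset $N_P\subseteq P^3$, closed under permuting the entries of a triple and under multiplying a triple by an element of $P$, such that $(1,0,0)\notin N_P$ and there is a unique $\epsilon\in P$ with $(1,\epsilon,0)\in N_P$; we write $a+b+c=0$ for $(a,b,c)\in N_P$. A \emph{pasture morphism} is a map preserving $0$, restricting to a homomorphism of unit groups and mapping nullset to nullset; $\mathrm{Mor}(P,Q)$ is the set of these. A field is viewed as a pasture with $N=\{(a,b,c): a+b+c=0\}$. A pair $(a,b)$ of elements of $P^\times$ is a \emph{fundamental pair} if $a+b+\epsilon=0$ (i.e. "$a+b=1$"), and then $a$ is a \emph{fundamental element}. For a finite matroid $M$ of rank $r$ on $E$, a \emph{$P$-representation} of $M$ is a map $\Delta:E^r\to P$ that is nonzero exactly on the tuples whose entries form a basis, satisfies $\Delta(x_{\sigma(1)},\dots,x_{\sigma(r)})=\epsilon^{\mathrm{sgn}\,\sigma}\Delta(x_1,\dots,x_r)$ (with $\mathrm{sgn}\,\sigma\in\{0,1\}$) for $\sigma \in S_r$, and satisfies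 $$\Delta(Je_1e_2)\Delta(Je_3e_4)+\epsilon\,\Delta(Je_1e_3)\Delta(Je_2e_4)+\Delta(Je_1e_4)\Delta(Je_2e_3)=0$$ for all $J\in E^{r-2}$ and $e_1,\dots,e_4\in E$ (no condition if $r<2$). Two $P$-representations $\Delta,\Delta'$ are \emph{rescaling equivalent} if $\Delta'(x_1,\dots,x_r)=c\,d(x_1)\cdots d(x_r)\Delta(x_1,\dots,x_r)$ for some $c\in P^\times$ and $d:E\to P^\times$. The \emph{foundation} $F_M$ is the pasture representing the functor that sends a pasture $P$ to the set of rescaling classes of $P$-representations of $M$. Explicitly, let $T$ be the abelian group generated by $\epsilon$ and symbols $X_b$ for the ordered bases $b$ of $M$, modulo $\epsilon^2=1$, $X_{b\circ\sigma}=\epsilon^{\mathrm{sgn}\,\sigma}X_b$, and $X_{Je_1e_3}X_{Je_2e_4}=X_{Je_1e_4}X_{Je_2e_3}$ whenever these four tuples are bases and $Je_1e_2$ is not. Then $F_M^\times$ is the subgroup of elements of degree $0$, for the degree $T\to\mathbb Z\times\mathbb Z^E$ given by $\epsilon\mapsto 0$, $X_b\mapsto(1,\sum_{i\in b}e_i)$,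 and the nullset of $F_M$ consists of the $F_M$-multiples and permutations of $(1,\epsilon,0)$ and of the degree-$0$ $T$-multiples of $(X_{Je_1e_2}X_{Je_3e_4},\ \epsilon X_{Je_1e_3}X_{Je_2e_4},\ X_{Je_1e_4}X_{Je_2e_3})$, where all six tuples are bases. Let $$P_0=\mathbb F_1^\pm\langle x,y,z,w\rangle\sslash\{x+y-1,\ x+z-1,\ \tfrac{y}{z}+w-1\},$$ that is, the pasture whose unit group is $\{\pm1\}$ times the free abelian group on $x,y,z,w$, with $\epsilon=-1$, and whose nullset consists of the $P_0$-multiples and permutations of $(1,-1,0)$, $(x,y,-1)$, $(x,z,-1)$ and $(y/z,w,-1)$. \begin{enumerate} \item There is no pasture morphism from $P_0$ to any field. \item If $M$ is a finite matroid with $\mathrm{Mor}(P_0,F_M)\neq\emptyset$, then $M$ is representable over no field $k$: it has no $k$-representation in the above sense, and it is not the matroid of the columns of a matrix over $k$. This holds for the explicit $F_M$ and for every pasture representing the functor above. \item If $P$ is a pasture in which $1$ is a fundamental element, then there is a pasture morphism $P_0\to P$. More precisely, for every $a$ such that $(a,1)$ is a fundamental pair of $P$ there is a pasture morphism $P_0\to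 P$ with $x,w\mapsto a$ and $y,z\mapsto 1$. \end{enumerate} -/

import Mathlib

universe u v w

/-! ## Pastures -/

/-- A pasture: a commutative monoid with absorbing element `0` whose nonzero elements form an
abelian group, with a nullset of triples satisfying the three pasture axioms. The element `eps`
is the unique element `e` such that `(1, e, 0)` lies in the nullset. -/
structure Pasture where
  carrier : Type u
  [grp : CommGroupWithZero carrier]
  null : Set (Fin 3 → carrier)
  eps : carrier
  one_zero_zero : ![1, 0, 0] ∉ null
  one_eps_zero : ![1, eps, 0] ∈ null
  eps_unique : ∀ e : carrier, ![1, e, 0] ∈ null → e = eps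
  perm_mul : ∀ a ∈ null, ∀ (σ : Equiv.Perm (Fin 3)) (p : carrier), (fun i => a (σ i) * p) ∈ null

namespace Pasture

instance : CoeSort Pasture.{u} (Type u) := ⟨Pasture.carrier⟩

instance (P : Pasture.{u}) : CommGroupWithZero P := P.grp

/-- A pasture morphism: it preserves `0`, restricts to a group homomorphism on nonzero elements
and maps the nullset into the nullset. -/
structure Hom (P : Pasture.{u}) (Q : Pasture.{v}) extends P →*₀ Q where
  map_null : ∀ a ∈ P.null, (fun i => toFun (a i)) ∈ Q.null

instance (P : Pasture.{u}) (Q : Pasture.{v}) : CoeFun (Hom P Q) (fun _ => P → Q) :=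
  ⟨fun f => f.toFun⟩

/-- Composition of pasture morphisms. -/
def Hom.comp {P : Pasture.{u}} {Q : Pasture.{v}} {R : Pasture.{w}} (g : Hom Q R) (f : Hom P Q) :
    Hom P R where
  toMonoidWithZeroHom := g.toMonoidWithZeroHom.comp f.toMonoidWithZeroHom
  map_null := fun a ha => g.map_null _ (f.map_null a ha)

/-- `(x, y)` is a fundamental pair: `x, y ≠ 0` and `x + y + ε = 0`, that is, `x + y = 1`. -/
def IsFundamentalPair (P : Pasture.{u}) (x y : P) : Prop :=
  x ≠ 0 ∧ y ≠ 0 ∧ ![x, y, P.eps] ∈ P.null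

/-- `x` is a fundamental element: it has a partner `y`. -/
def IsFundamental (P : Pasture.{u}) (x : P) : Prop := ∃ y : P, P.IsFundamentalPair x y

/-- A field, viewed as a pasture. -/
def ofField (k : Type u) [Field k] : Pasture.{u} where
  carrier := k
  null := {a | a 0 + a 1 + a 2 = 0}
  eps := -1
  one_zero_zero := by simp
  one_eps_zero := by simp
  eps_unique := fun e he => by
    have h : (1 : k) + e = 0 := by simpa using he
    exact (neg_eq_of_add_eq_zero_right h).symm
  perm_mul := fun a ha σ p => by
    have h : ∑ i, a (σ i) = ∑ i, a i := Equiv.sum_comp σ a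
    simp only [Fin.sum_univ_three] at h
    have ha' : a 0 + a 1 + a 2 = 0 := ha
    change a (σ 0) * p + a (σ 1) * p + a (σ 2) * p = 0
    rw [← add_mul, ← add_mul, h, ha', zero_mul]

/-- The pasture with unit group `G`, distinguished element `ε` and as nullset the union of the
`S₃ × P`-orbits of `(1, ε, 0)` and of the triples of units in `R`: the relations imposed
are exactly the three-term relations `t 0 + t 1 + t 2 = 0` for `t ∈ R`. -/
def ofTriples (G : Type u) [CommGroup G] (ε : G) (hε : ε * ε = 1) (R : Set (Fin 3 → G)) :
    Pasture.{u} where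
  carrier := WithZero G
  null := {a | (∃ (σ : Equiv.Perm (Fin 3)) (p : WithZero G),
        a = fun i => (![1, (ε : WithZero G), 0] : Fin 3 → WithZero G) (σ i) * p) ∨
      ∃ t ∈ R, ∃ (σ : Equiv.Perm (Fin 3)) (p : WithZero G),
        a = fun i => (t (σ i) : WithZero G) * p}
  eps := (ε : WithZero G)
  one_zero_zero := by
    rintro (⟨σ, p, h⟩ | ⟨t, -, σ, p, h⟩)
    · have h0 := congrFun h 0
      have h1 := congrFun h 1
      have h2 := congrFun h 2
      have hp : p ≠ 0 := by
        rintro rfl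
        simp at h0
      have key : ∀ j : Fin 3, (![1, (ε : WithZero G), 0] : Fin 3 → WithZero G) j = 0 → j = 2 := by
        intro j
        fin_cases j <;> simp
      have e1 : σ 1 = 2 := key _ (by simpa [hp] using h1.symm)
      have e2 : σ 2 = 2 := key _ (by simpa [hp] using h2.symm)
      exact absurd (σ.injective (e1.trans e2.symm)) (by decide)
    · have h0 := congrFun h 0
      have h1 := congrFun h 1
      have hp : p = 0 := by simpa using h1.symm
      simp [hp] at h0
  one_eps_zero := Or.inl ⟨1, 1, by simp⟩
  eps_unique := by
    rintro e (⟨σ, p, h⟩ | ⟨t, -, σ, p, h⟩)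
    · have h0 := congrFun h 0
      have h1 := congrFun h 1
      have h2 := congrFun h 2
      have hp : p ≠ 0 := by
        rintro rfl
        simp at h0
      have key : ∀ j : Fin 3, (![1, (ε : WithZero G), 0] : Fin 3 → WithZero G) j = 0 → j = 2 := by
        intro j
        fin_cases j <;> simp
      have e2 : σ 2 = 2 := key _ (by simpa [hp] using h2.symm)
      have hεε : (ε : WithZero G) * ε = 1 := by
        rw [← WithZero.coe_mul, hε, WithZero.coe_one]
      have hcase : (σ 0 = 0 ∧ σ 1 = 1) ∨ (σ 0 = 1 ∧ σ 1 = 0) := by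
        revert e2
        clear h h0 h1 h2
        revert σ
        decide
      rcases hcase with ⟨a, b⟩ | ⟨a, b⟩
      · have hp1 : p = 1 := by simpa [a] using h0.symm
        simpa [b, hp1] using h1
      · have hp1 : (ε : WithZero G) * p = 1 := by simpa [a] using h0.symm
        have hpe : e = p := by simpa [b] using h1
        rw [hpe]
        calc p = (ε * ε) * p := by rw [hεε, one_mul]
          _ = ε := by rw [mul_assoc, hp1, mul_one]
    · have h0 := congrFun h 0
      have h2 := congrFun h 2
      have hp : p = 0 := by simpa using h2.symm
      simp [hp] at h0
  perm_mul := by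
    rintro a (⟨σ, p, rfl⟩ | ⟨t, ht, σ, p, rfl⟩) τ q
    · exact Or.inl ⟨τ.trans σ, p * q, by funext i; simp [mul_assoc]⟩
    · exact Or.inr ⟨t, ht, τ.trans σ, p * q, by funext i; simp [mul_assoc]⟩

/-! ## The pasture `P₀` -/

/-- The unit group `{±1} × ℤ^S` (written multiplicatively) of the free pasture
`F₁^±⟨s : s ∈ S⟩` on generators indexed by `S`. -/
abbrev FreeUnits (S : Type u) : Type u := ℤˣ × Multiplicative (S →₀ ℤ)

/-- The generator with index `s`. -/
noncomputable def gen {S : Type u} (s : S) : FreeUnits S :=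
  (1, Multiplicative.ofAdd (Finsupp.single s 1))

/-- The element `-1`. -/
def negOne (S : Type u) : FreeUnits S := (-1, 1)

/-- The pasture `F₁^±⟨s : s ∈ S⟩ ⫽ {a + b - 1 : (a, b) ∈ R}`, for a set `R` of pairs of units.
Such three-term relations do not identify any units, so only the nullset is enlarged. -/
noncomputable def presented (S : Type u) (R : Set (FreeUnits S × FreeUnits S)) : Pasture.{u} :=
  ofTriples (FreeUnits S) (negOne S) (by simp [negOne])
    {t | ∃ ab ∈ R, t = ![ab.1, ab.2, negOne S]}

/-- `P₀ = F₁^±⟨x, y, z, w⟩ ⫽ {x + y - 1, x + z - 1, y / z + w - 1}`; the generators `x, y, z, w`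
have the indices `0, 1, 2, 3`. -/
noncomputable def P0 : Pasture.{0} :=
  presented (Fin 4) {(gen 0, gen 1), (gen 0, gen 2), (gen 1 / gen 2, gen 3)}

/-- The generators `x, y, z, w` of `P₀` (in this order). -/
noncomputable def P0.gen (i : Fin 4) : P0 := ((Pasture.gen i : FreeUnits (Fin 4)) : WithZero _)

end Pasture

/-! ## Representations of matroids over pastures -/

namespace Matroid

open Pasture

variable {α : Type u}

/-- The rank of a matroid, as a natural number (used for finite matroids only). -/
noncomputable def rk' (M : Matroid α) : ℕ := M.eRank.toNat

/-- The tuples `(x₁, …, x_r)` of elements of the ground set, where `r` is the rank. -/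
abbrev Tuple (M : Matroid α) : Type u := Fin M.rk' → M.E

/-- The set `{x₁, …, x_r}` is a basis of `M`. -/
def IsBaseTuple (M : Matroid α) (x : M.Tuple) : Prop := M.IsBase (Set.range fun i => (x i : α))

/-- The tuple `J a b = (y₁, …, y_{r-2}, a, b)`, for `J = (y₁, …, y_{r-2})`. -/
noncomputable def tup (M : Matroid α) {m : ℕ} (h : m + 2 = M.rk') (J : Fin m → M.E) (a b : M.E) : M.Tuple :=
  fun i => Fin.append J ![a, b] (Fin.cast h.symm i)

/-- `ε ^ sgn σ`, with `sgn σ ∈ {0, 1}`. -/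
def signPow {G : Type*} [One G] (ε : G) {r : ℕ} (σ : Equiv.Perm (Fin r)) : G :=
  if Equiv.Perm.sign σ = 1 then 1 else ε

/-- A `P`-representation of `M`. -/
@[ext]
structure Rep (M : Matroid α) (P : Pasture.{v}) where
  toFun : M.Tuple → P
  gp1 : ∀ x, toFun x ≠ 0 ↔ M.IsBaseTuple x
  gp2 : ∀ (x : M.Tuple) (σ : Equiv.Perm (Fin M.rk')), toFun (x ∘ σ) = signPow P.eps σ * toFun x
  gp3 : ∀ (m : ℕ) (h : m + 2 = M.rk') (J : Fin m → M.E) (e₁ e₂ e₃ e₄ : M.E),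
    ![toFun (M.tup h J e₁ e₂) * toFun (M.tup h J e₃ e₄),
      P.eps * (toFun (M.tup h J e₁ e₃) * toFun (M.tup h J e₂ e₄)),
      toFun (M.tup h J e₁ e₄) * toFun (M.tup h J e₂ e₃)] ∈ P.null

/-- `M` is representable over the pasture `P`. -/
def RepresentableOver (M : Matroid α) (P : Pasture.{v}) : Prop := Nonempty (M.Rep P)

/-- `M` is the vector matroid of the columns of a matrix over the field `k`: the column at
`i ∈ E` is `A i`, and independence in `M` is linear independence of columns. -/
def IsVectorMatroidOver (M : Matroid α) (k : Type v) [Field k] : Prop :=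
  ∃ (n : ℕ) (A : α → Fin n → k), ∀ I ⊆ M.E, M.Indep I ↔ LinearIndepOn k A I

end Matroid

theorem Pasture.Hom.map_eps {P : Pasture.{u}} {Q : Pasture.{v}} (f : Pasture.Hom P Q) :
    f P.eps = Q.eps := by
  apply Q.eps_unique
  have h := f.map_null _ P.one_eps_zero
  have e : (fun i => f.toFun ((![1, P.eps, 0] : Fin 3 → P) i)) = ![1, f P.eps, 0] := by
    funext i
    fin_cases i
    · exact map_one f.toMonoidWithZeroHom
    · rfl
    · exact map_zero f.toMonoidWithZeroHom
  exact e ▸ h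

namespace Matroid

open Pasture

variable {α : Type u}

/-- Pushforward of a representation along a pasture morphism. -/
def Rep.map {M : Matroid α} {P : Pasture.{v}} {Q : Pasture.{w}} (f : Hom P Q) (Δ : M.Rep P) :
    M.Rep Q where
  toFun := fun x => f (Δ.toFun x)
  gp1 := fun x => by
    rw [← Δ.gp1 x]
    exact map_ne_zero f.toMonoidWithZeroHom
  gp2 := fun x σ => by
    have hs : f (signPow P.eps σ) = signPow Q.eps σ := by
      unfold signPow
      split_ifs
      · exact map_one f.toMonoidWithZeroHom
      · exact f.map_eps
    rw [Δ.gp2, ← hs]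
    exact map_mul f.toMonoidWithZeroHom _ _
  gp3 := fun m h J e₁ e₂ e₃ e₄ => by
    have hmul : ∀ a b : P, f (a * b) = f a * f b := map_mul f.toMonoidWithZeroHom
    have key := f.map_null _ (Δ.gp3 m h J e₁ e₂ e₃ e₄)
    convert key using 1
    funext i
    fin_cases i
    · exact (hmul _ _).symm
    · change Q.eps * (f _ * f _) = f (P.eps * (_ * _))
      rw [hmul, hmul, f.map_eps]
    · exact (hmul _ _).symm

/-- Rescaling equivalence of two `P`-representations of `M`. -/
def RescalingEquiv {M : Matroid α} {P : Pasture.{v}} (Δ Δ' : M.Rep P) : Prop :=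
  ∃ (c : Pˣ) (d : M.E → Pˣ), ∀ x : M.Tuple,
    Δ'.toFun x = (c : P) * (∏ i, (d (x i) : P)) * Δ.toFun x

/-- The setoid of rescaling equivalence. -/
def rescalingSetoid (M : Matroid α) (P : Pasture.{v}) : Setoid (M.Rep P) where
  r := RescalingEquiv
  iseqv :=
    { refl := fun Δ => ⟨1, fun _ => 1, fun x => by simp⟩
      symm := by
        rintro Δ Δ' ⟨c, d, h⟩
        refine ⟨c⁻¹, fun i => (d i)⁻¹, fun x => ?_⟩
        have hd : (∏ i, (d (x i) : P)) ≠ 0 := Finset.prod_ne_zero_iff.2 fun i _ => (d (x i)).ne_zero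
        have hc : (c : P) ≠ 0 := c.ne_zero
        rw [h x]
        simp only [Units.val_inv_eq_inv_val, Finset.prod_inv_distrib]
        field_simp
      trans := by
        rintro Δ Δ' Δ'' ⟨c, d, h⟩ ⟨c', d', h'⟩
        refine ⟨c' * c, fun i => d' i * d i, fun x => ?_⟩
        rw [h' x, h x]
        simp only [Units.val_mul, Finset.prod_mul_distrib]
        simp only [mul_assoc, mul_left_comm, mul_comm] }

/-- The set of rescaling equivalence classes of `P`-representations of `M`. -/
def RescalingClass (M : Matroid α) (P : Pasture.{v}) : Type (max u v) :=
  Quotient (M.rescalingSetoid P)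

/-- Pushforward of rescaling classes along a pasture morphism. -/
def RescalingClass.map {M : Matroid α} {P : Pasture.{v}} {Q : Pasture.{w}} (f : Hom P Q) :
    M.RescalingClass P → M.RescalingClass Q :=
  Quotient.map (Rep.map f) (by
    rintro Δ Δ' ⟨c, d, h⟩
    refine ⟨Units.map f.toMonoidWithZeroHom.toMonoidHom c,
      fun i => Units.map f.toMonoidWithZeroHom.toMonoidHom (d i), fun x => ?_⟩
    change f.toMonoidWithZeroHom (Δ'.toFun x) = f.toMonoidWithZeroHom (c : P) *
      (∏ i, f.toMonoidWithZeroHom (d (x i) : P)) * f.toMonoidWithZeroHom (Δ.toFun x)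
    rw [h x, map_mul, map_mul, map_prod])

/-- `F` represents the functor sending a pasture (in the universe `v`) to the set of rescaling
classes of representations of `M` over it: the universal property of the foundation. -/
def IsFoundation (M : Matroid α) (F : Pasture.{w}) : Prop :=
  ∃ e : ∀ P : Pasture.{v}, M.RescalingClass P ≃ Hom F P,
    ∀ (P Q : Pasture.{v}) (f : Hom P Q) (c : M.RescalingClass P), e Q (c.map f) = f.comp (e P c)

/-! ## The construction of the foundation -/

/-- The ordered bases of `M`. -/
abbrev OrderedBase (M : Matroid α) : Type u := {x : M.Tuple // M.IsBaseTuple x}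

/-- The free abelian group, written multiplicatively, on a symbol `ε` (the generator `none`) and
on symbols `X_b` for the ordered bases `b` of `M`. -/
abbrev TutteFree (M : Matroid α) : Type u :=
  Multiplicative (FreeAbelianGroup (Option M.OrderedBase))

/-- The symbol `ε`. -/
def freeEps (M : Matroid α) : M.TutteFree := Multiplicative.ofAdd (FreeAbelianGroup.of none)

/-- The symbol `X_b`. -/
def freeX {M : Matroid α} (b : M.OrderedBase) : M.TutteFree :=
  Multiplicative.ofAdd (FreeAbelianGroup.of (some b))

/-- The relators of the (extended) Tutte group: `ε² = 1`, `X` is alternating up to `ε`, and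
degenerate cross-ratios are trivial. -/
inductive TutteRelator (M : Matroid α) : M.TutteFree → Prop
  | eps_sq : TutteRelator M (M.freeEps * M.freeEps)
  | alt (b b' : M.OrderedBase) (σ : Equiv.Perm (Fin M.rk')) (h : b'.1 = b.1 ∘ σ) :
      TutteRelator M (freeX b' * (signPow M.freeEps σ * freeX b)⁻¹)
  | degenerate (m : ℕ) (h : m + 2 = M.rk') (J : Fin m → M.E) (e₁ e₂ e₃ e₄ : M.E)
      (b₁₃ b₂₄ b₁₄ b₂₃ : M.OrderedBase)
      (h₁₂ : ¬ M.IsBaseTuple (M.tup h J e₁ e₂))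
      (h₁₃ : b₁₃.1 = M.tup h J e₁ e₃) (h₂₄ : b₂₄.1 = M.tup h J e₂ e₄)
      (h₁₄ : b₁₄.1 = M.tup h J e₁ e₄) (h₂₃ : b₂₃.1 = M.tup h J e₂ e₃) :
      TutteRelator M (freeX b₁₃ * freeX b₂₄ * (freeX b₁₄ * freeX b₂₃)⁻¹)

/-- The subgroup generated by the relators. -/
def tutteRelations (M : Matroid α) : Subgroup M.TutteFree :=
  Subgroup.closure {g | M.TutteRelator g}

/-- The extended Tutte group of `M`. -/
abbrev TutteGroup (M : Matroid α) : Type u := M.TutteFree ⧸ M.tutteRelations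

/-- The class of `ε` in the extended Tutte group. -/
def tutteEps (M : Matroid α) : M.TutteGroup := QuotientGroup.mk M.freeEps

/-- The class of `X_b` in the extended Tutte group. -/
def tutteX {M : Matroid α} (b : M.OrderedBase) : M.TutteGroup := QuotientGroup.mk (freeX b)

/-- The degree on the free group: `ε` has degree `0`, and `X_b` has degree
`(1, ∑_{i ∈ b} e_i)` in `ℤ × ℤ^E`. -/
noncomputable def freeDegree (M : Matroid α) : M.TutteFree →* Multiplicative (ℤ × (M.E →₀ ℤ)) :=
  AddMonoidHom.toMultiplicative (FreeAbelianGroup.lift fun s : Option M.OrderedBase =>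
    s.elim 0 fun b => ((1 : ℤ), ∑ i, Finsupp.single (b.1 i) (1 : ℤ)))

theorem freeDegree_eps (M : Matroid α) : M.freeDegree M.freeEps = 1 := by
  simp [freeDegree, freeEps]

theorem freeDegree_X {M : Matroid α} (b : M.OrderedBase) :
    M.freeDegree (freeX b) =
      Multiplicative.ofAdd ((1 : ℤ), ∑ i, Finsupp.single (b.1 i) (1 : ℤ)) := by
  simp [freeDegree, freeX]

theorem sum_tup (M : Matroid α) {m : ℕ} (h : m + 2 = M.rk') (J : Fin m → M.E) (a b : M.E) :
    ∑ i, Finsupp.single (M.tup h J a b i) (1 : ℤ) =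
      (∑ i, Finsupp.single (J i) (1 : ℤ)) + (Finsupp.single a 1 + Finsupp.single b 1) := by
  have e := Equiv.sum_comp (finCongr h) fun i => Finsupp.single (M.tup h J a b i) (1 : ℤ)
  rw [← e, Fin.sum_univ_add]
  simp [tup, Fin.sum_univ_two]

theorem tutteRelations_le (M : Matroid α) : M.tutteRelations ≤ M.freeDegree.ker := by
  refine (Subgroup.closure_le _).2 ?_
  rintro g (_ | ⟨b, b', σ, h⟩ | ⟨m, h, J, e₁, e₂, e₃, e₄, b₁₃, b₂₄, b₁₄, b₂₃, -, h₁₃, h₂₄, h₁₄, h₂₃⟩)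
  · simp [MonoidHom.mem_ker, freeDegree_eps]
  · have hs : M.freeDegree (signPow M.freeEps σ) = 1 := by
      unfold signPow
      split_ifs
      · exact map_one _
      · exact M.freeDegree_eps
    have e := Equiv.sum_comp σ fun i => Finsupp.single (b.1 i) (1 : ℤ)
    simp only [SetLike.mem_coe, MonoidHom.mem_ker, map_mul, map_inv, hs, one_mul, freeDegree_X]
    rw [h]
    simp only [Function.comp_apply, e, mul_inv_cancel]
  · simp only [SetLike.mem_coe, MonoidHom.mem_ker, map_mul, map_inv, freeDegree_X, h₁₃, h₂₄, h₁₄,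
      h₂₃, sum_tup, mul_inv_eq_one, ← ofAdd_add, Prod.mk_add_mk]
    congr 2
    abel

/-- The degree map of the extended Tutte group. -/
noncomputable def tutteDegree (M : Matroid α) :
    M.TutteGroup →* Multiplicative (ℤ × (M.E →₀ ℤ)) :=
  QuotientGroup.lift M.tutteRelations M.freeDegree M.tutteRelations_le

/-- The inner Tutte group: the elements of degree zero. -/
abbrev InnerTutteGroup (M : Matroid α) : Type u := M.tutteDegree.ker

/-- The element `ε` of the inner Tutte group. -/
noncomputable def innerEps (M : Matroid α) : M.InnerTutteGroup :=
  ⟨M.tutteEps, by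
    rw [MonoidHom.mem_ker]
    exact M.freeDegree_eps⟩

theorem innerEps_sq (M : Matroid α) : M.innerEps * M.innerEps = 1 := by
  apply Subtype.ext
  exact (QuotientGroup.eq_one_iff _).2 (Subgroup.subset_closure TutteRelator.eps_sq)

/-- The three-term Grassmann–Plücker relations of `M` with three nonzero terms. -/
def pluckerTriples (M : Matroid α) : Set (Fin 3 → M.TutteGroup) :=
  {t | ∃ (m : ℕ) (h : m + 2 = M.rk') (J : Fin m → M.E) (e₁ e₂ e₃ e₄ : M.E)
    (b₁₂ b₃₄ b₁₃ b₂₄ b₁₄ b₂₃ : M.OrderedBase),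
    b₁₂.1 = M.tup h J e₁ e₂ ∧ b₃₄.1 = M.tup h J e₃ e₄ ∧
    b₁₃.1 = M.tup h J e₁ e₃ ∧ b₂₄.1 = M.tup h J e₂ e₄ ∧
    b₁₄.1 = M.tup h J e₁ e₄ ∧ b₂₃.1 = M.tup h J e₂ e₃ ∧
    t = ![tutteX b₁₂ * tutteX b₃₄, M.tutteEps * (tutteX b₁₃ * tutteX b₂₄),
      tutteX b₁₄ * tutteX b₂₃]}

/-- The foundation of `M`: its unit group is the inner Tutte group, and its three-term relations
are the degree-zero multiples of the three-term Grassmann–Plücker relations. -/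
noncomputable def foundation (M : Matroid α) : Pasture.{u} :=
  ofTriples M.InnerTutteGroup M.innerEps M.innerEps_sq
    {t | ∃ (g : M.TutteGroup), ∃ s ∈ M.pluckerTriples, ∀ i, (t i : M.TutteGroup) = s i * g}

end Matroid

/-! In a field, `x + y = 1` and `x + z = 1` force `y = z` by cancellation, so `y / z + w = 1` reads
`1 + w = 1` and `w = 0`. But `w` is a unit of `P₀`, and morphisms send units to units; hence
`isEmpty_hom_P0_ofField`. Pastures have no cancellation: sending `x, w` to `a` and `y, z` to `1`
turns all three relations into `a + 1 = 1`, which may well hold (`exists_hom_P0`).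

A representation of `M` over a field `k` yields a morphism from the foundation to `k`. Composing it
with a morphism from `P₀` to the foundation gives a forbidden morphism to `k`. For a representing
pasture this morphism comes from the universal property; for the explicit `foundation` it is
`foundationHom`, built from `X_b ↦ Δ(b)`.

A column matroid over `k` has a `k`-representation, namely a determinant form on the column span;
its axioms amount to the three-term Grassmann–Plücker relation. So excluding representations also
excludes matrices. -/

namespace Pasture

/-! ### Null triples, and morphisms out of pastures given by generators and relations -/

theorem null_rotate (P : Pasture.{u}) {a b c : P} (h : ![a, b, c] ∈ P.null) :
    ![b, c, a] ∈ P.null := by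
  convert P.perm_mul _ h (finRotate 3) 1 using 1
  funext i
  fin_cases i <;> simp

theorem null_mul (P : Pasture.{u}) {a b c : P} (h : ![a, b, c] ∈ P.null) (p : P) :
    ![a * p, b * p, c * p] ∈ P.null := by
  convert P.perm_mul _ h 1 p using 1
  funext i
  fin_cases i <;> simp

theorem null_swap (P : Pasture.{u}) {a b c : P} (h : ![a, b, c] ∈ P.null) :
    ![b, a, c] ∈ P.null := by
  convert P.perm_mul _ h (Equiv.swap 0 1) 1 using 1
  funext i
  fin_cases i
  · simp
  · simp
  · have : Equiv.swap (0 : Fin 3) 1 2 = 2 := by decide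
    simp [this]

theorem eps_ne_zero (P : Pasture.{u}) : P.eps ≠ 0 := fun h =>
  P.one_zero_zero (by simpa only [h] using P.one_eps_zero)

/-- Scaling by `a⁻¹` reduces this to the uniqueness of `ε`. It lets a three-term relation with one
vanishing term be solved as an equation between units. -/
theorem eq_eps_mul_of_null (P : Pasture.{u}) {a b : P} (ha : a ≠ 0) (h : ![a, b, 0] ∈ P.null) :
    b = P.eps * a := by
  have h' := P.null_mul h a⁻¹
  rw [mul_inv_cancel₀ ha, zero_mul] at h'
  rw [← P.eps_unique _ h', inv_mul_cancel_right₀ ha]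

theorem eps_mul_eps (P : Pasture.{u}) : P.eps * P.eps = 1 :=
  (P.eq_eps_mul_of_null P.eps_ne_zero (P.null_swap P.one_eps_zero)).symm

/-- The element `ε` as a unit. -/
def epsUnit (P : Pasture.{u}) : (P : Type u)ˣ := ⟨P.eps, P.eps, P.eps_mul_eps, P.eps_mul_eps⟩

/-- A group homomorphism into the units of `P` that respects `ε` and the relations in `R`
induces a pasture morphism. -/
noncomputable def ofTriplesLift {G : Type u} [CommGroup G] {ε : G} {hε : ε * ε = 1}
    {R : Set (Fin 3 → G)} {P : Pasture.{v}} (φ : G →* (P : Type v)ˣ) (hφ : (φ ε : P) = P.eps)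
    (hR : ∀ t ∈ R, (fun i => (φ (t i) : P)) ∈ P.null) : Hom (ofTriples G ε hε R) P where
  toMonoidWithZeroHom := WithZero.lift' ((Units.coeHom P).comp φ)
  map_null := by
    set f : WithZero G →*₀ P := WithZero.lift' ((Units.coeHom P).comp φ) with hf
    have hcoe : ∀ g : G, f (g : WithZero G) = (φ g : P) := fun g => by simp [hf]
    -- The nullset is a union of orbits under permutation and scaling, so checking one triple per
    -- orbit suffices.
    rintro a (⟨σ, p, rfl⟩ | ⟨t, ht, σ, p, rfl⟩)
    · convert P.perm_mul _ P.one_eps_zero σ (f p) using 1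
      funext i
      change f (_ * p) = _
      rw [map_mul]
      congr 1
      generalize σ i = j
      fin_cases j
      · exact map_one f
      · exact (hcoe ε).trans hφ
      · exact map_zero f
    · convert P.perm_mul _ (hR t ht) σ (f p) using 1
      funext i
      change f (_ * p) = _
      rw [map_mul, hcoe]

theorem ofTriplesLift_coe {G : Type u} [CommGroup G] {ε : G} {hε : ε * ε = 1}
    {R : Set (Fin 3 → G)} {P : Pasture.{v}} (φ : G →* (P : Type v)ˣ) (hφ : (φ ε : P) = P.eps)
    (hR : ∀ t ∈ R, (fun i => (φ (t i) : P)) ∈ P.null) (g : G) :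
    (ofTriplesLift (hε := hε) φ hφ hR) (g : WithZero G) = (φ g : P) :=
  WithZero.lift'_coe _ g

/-- The homomorphism `{±1} → Pˣ` with `-1 ↦ ε`. -/
def signHom (P : Pasture.{u}) : ℤˣ →* (P : Type u)ˣ where
  toFun s := if s = 1 then 1 else P.epsUnit
  map_one' := by simp
  map_mul' s t := by
    have h : P.epsUnit * P.epsUnit = 1 := Units.ext P.eps_mul_eps
    rcases Int.units_eq_one_or s with rfl | rfl <;> rcases Int.units_eq_one_or t with rfl | rfl <;>
      simp [h]

/-- The homomorphism `{±1} × ℤ^S → Pˣ` with `-1 ↦ ε` and prescribed values on the generators. -/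
noncomputable def freeUnitsLift {S : Type v} (P : Pasture.{u}) (a : S → (P : Type u)ˣ) :
    FreeUnits S →* (P : Type u)ˣ :=
  P.signHom.coprod <| AddMonoidHom.toMultiplicativeLeft <|
    Finsupp.liftAddHom fun s => zmultiplesHom _ (Additive.ofMul (a s))

theorem freeUnitsLift_gen {S : Type v} (P : Pasture.{u}) (a : S → (P : Type u)ˣ) (s : S) :
    P.freeUnitsLift a (gen s) = a s := by
  simp [freeUnitsLift, gen]

theorem freeUnitsLift_negOne {S : Type v} (P : Pasture.{u}) (a : S → (P : Type u)ˣ) :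
    P.freeUnitsLift a (negOne S) = P.epsUnit := by
  simp [freeUnitsLift, negOne, signHom]

/-! ### Morphisms from `P₀` -/

theorem exists_hom_P0 (P : Pasture.{u}) (a : P) (h : P.IsFundamentalPair a 1) :
    ∃ f : Hom P0 P, f (P0.gen 0) = a ∧ f (P0.gen 1) = 1 ∧ f (P0.gen 2) = 1 ∧
      f (P0.gen 3) = a := by
  obtain ⟨ha, -, hn⟩ := h
  set A : Fin 4 → (P : Type u)ˣ := ![Units.mk0 a ha, 1, 1, Units.mk0 a ha] with hA
  have hneg : (P.freeUnitsLift A (negOne (Fin 4)) : P) = P.eps := by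
    rw [freeUnitsLift_negOne]; rfl
  have hR : ∀ t ∈ {t : Fin 3 → FreeUnits (Fin 4) | ∃ ab ∈
      ({(Pasture.gen 0, Pasture.gen 1), (Pasture.gen 0, Pasture.gen 2),
        (Pasture.gen 1 / Pasture.gen 2, Pasture.gen 3)} :
        Set (FreeUnits (Fin 4) × FreeUnits (Fin 4))), t = ![ab.1, ab.2, negOne (Fin 4)]},
      (fun i => (P.freeUnitsLift A (t i) : P)) ∈ P.null := by
    rintro t ⟨ab, hab, rfl⟩
    have key : (fun i => (P.freeUnitsLift A (![ab.1, ab.2, negOne (Fin 4)] i) : P)) =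
        ![(P.freeUnitsLift A ab.1 : P), (P.freeUnitsLift A ab.2 : P), P.eps] := by
      funext i
      fin_cases i
      · rfl
      · rfl
      · exact hneg
    rw [key]
    rcases hab with rfl | rfl | rfl
    · simpa [freeUnitsLift_gen, hA] using hn
    · simpa [freeUnitsLift_gen, hA] using hn
    -- Here `y / z ↦ 1` stands first and `w ↦ a` second, so the entries come in the opposite order.
    · simpa [freeUnitsLift_gen, hA] using P.null_swap hn
  have hg : ∀ i, ofTriplesLift (hε := by simp [negOne]) (P.freeUnitsLift A) hneg hR
      (P0.gen i : WithZero (FreeUnits (Fin 4))) = (A i : P) := fun i =>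
    (ofTriplesLift_coe _ hneg hR _).trans (by rw [freeUnitsLift_gen])
  exact ⟨ofTriplesLift (P.freeUnitsLift A) hneg hR, hg 0, hg 1, hg 2, hg 3⟩

theorem P0_null {a b : FreeUnits (Fin 4)}
    (h : (a, b) ∈ ({(Pasture.gen 0, Pasture.gen 1), (Pasture.gen 0, Pasture.gen 2),
        (Pasture.gen 1 / Pasture.gen 2, Pasture.gen 3)} :
        Set (FreeUnits (Fin 4) × FreeUnits (Fin 4)))) :
    (![(a : WithZero (FreeUnits (Fin 4))), b, (negOne (Fin 4) : FreeUnits (Fin 4))] :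
      Fin 3 → WithZero (FreeUnits (Fin 4))) ∈ P0.null := by
  refine Or.inr ⟨![a, b, negOne (Fin 4)], ⟨(a, b), h, rfl⟩, 1, 1, ?_⟩
  funext i
  fin_cases i <;> simp

theorem isEmpty_hom_P0_ofField (k : Type u) [Field k] : IsEmpty (Hom P0 (ofField k)) := by
  refine ⟨fun f => ?_⟩
  let F : WithZero (FreeUnits (Fin 4)) →*₀ k := f.toMonoidWithZeroHom
  have hε : F ((negOne (Fin 4) : FreeUnits (Fin 4)) : WithZero (FreeUnits (Fin 4))) = -1 :=
    f.map_eps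
  have rel : ∀ {a b : FreeUnits (Fin 4)}, (a, b) ∈ ({(Pasture.gen 0, Pasture.gen 1),
      (Pasture.gen 0, Pasture.gen 2), (Pasture.gen 1 / Pasture.gen 2, Pasture.gen 3)} :
        Set (FreeUnits (Fin 4) × FreeUnits (Fin 4))) →
      F (a : WithZero (FreeUnits (Fin 4))) + F (b : WithZero (FreeUnits (Fin 4))) = 1 := by
    -- Since `-1` of `P₀` must go to `-1` of the field, null triples `(a, b, -1)` become genuine
    -- equations.
    intro a b hab
    have h : F (a : WithZero (FreeUnits (Fin 4))) + F (b : WithZero (FreeUnits (Fin 4))) +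
      F ((negOne (Fin 4) : FreeUnits (Fin 4)) : WithZero (FreeUnits (Fin 4))) = 0 :=
        f.map_null _ (P0_null hab)
    rw [hε] at h
    linear_combination h
  have hne : ∀ a : FreeUnits (Fin 4), F (a : WithZero (FreeUnits (Fin 4))) ≠ 0 := fun a =>
    (map_ne_zero F).2 WithZero.coe_ne_zero
  have h1 := rel (Or.inl rfl)
  have h2 := rel (Or.inr (Or.inl rfl))
  have h3 := rel (Or.inr (Or.inr rfl))
  rw [WithZero.coe_div, map_div₀, show F ((gen 1 : FreeUnits (Fin 4)) : WithZero _) =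
    F ((gen 2 : FreeUnits (Fin 4)) : WithZero _) by linear_combination h1 - h2,
    div_self (hne _)] at h3
  exact hne (gen 3) (by linear_combination h3)

end Pasture

/-! ### From a representation to a morphism out of the foundation -/

namespace Matroid

open Pasture

variable {α : Type u} {M : Matroid α} {P : Pasture.{v}}

namespace Rep

/-- The value of a representation at an ordered basis, as a unit. -/
noncomputable def unitAt (Δ : M.Rep P) (b : M.OrderedBase) : (P : Type v)ˣ :=
  Units.mk0 (Δ.toFun b.1) ((Δ.gp1 b.1).2 b.2)

/-- The homomorphism from the free group on `ε` and the `X_b` given by a representation. -/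
noncomputable def freeHom (Δ : M.Rep P) : M.TutteFree →* (P : Type v)ˣ :=
  AddMonoidHom.toMultiplicativeLeft (FreeAbelianGroup.lift fun s : Option M.OrderedBase =>
    Additive.ofMul (s.elim P.epsUnit Δ.unitAt))

theorem freeHom_eps (Δ : M.Rep P) : Δ.freeHom M.freeEps = P.epsUnit := by
  simp [freeHom, freeEps]

theorem freeHom_X (Δ : M.Rep P) (b : M.OrderedBase) : Δ.freeHom (freeX b) = Δ.unitAt b := by
  simp [freeHom, freeX]

theorem tutteRelations_le_ker (Δ : M.Rep P) : M.tutteRelations ≤ Δ.freeHom.ker := by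
  refine (Subgroup.closure_le _).2 ?_
  rintro g (_ | ⟨b, b', σ, h⟩ | ⟨m, h, J, e₁, e₂, e₃, e₄, b₁₃, b₂₄, b₁₄, b₂₃, h₁₂, h₁₃, h₂₄, h₁₄, h₂₃⟩)
  · rw [SetLike.mem_coe, MonoidHom.mem_ker, map_mul, freeHom_eps]
    exact Units.ext P.eps_mul_eps
  · rw [SetLike.mem_coe, MonoidHom.mem_ker, map_mul, map_inv, mul_inv_eq_one, map_mul, freeHom_X,
      freeHom_X]
    have hs : ((Δ.freeHom (signPow M.freeEps σ) : (P : Type v)ˣ) : P) = signPow P.eps σ := by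
      unfold signPow
      split_ifs
      · simp
      · rw [freeHom_eps]; rfl
    apply Units.ext
    rw [Units.val_mul, hs]
    change Δ.toFun b'.1 = _ * Δ.toFun b.1
    rw [h, Δ.gp2]
  · rw [SetLike.mem_coe, MonoidHom.mem_ker, map_mul, map_inv, mul_inv_eq_one, map_mul, map_mul]
    simp only [freeHom_X]
    have hn := Δ.gp3 m h J e₁ e₂ e₃ e₄
    -- As `J e₁ e₂` is not a basis, the first Plücker product vanishes. The other two terms give
    -- `Δ₁₄ Δ₂₃ = ε · (ε Δ₁₃ Δ₂₄) = Δ₁₃ Δ₂₄`.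
    rw [← h₁₃, ← h₂₄, ← h₁₄, ← h₂₃, not_not.1 (mt (Δ.gp1 _).1 h₁₂), zero_mul] at hn
    have hne : P.eps * (Δ.toFun b₁₃.1 * Δ.toFun b₂₄.1) ≠ 0 :=
      mul_ne_zero P.eps_ne_zero
        (mul_ne_zero ((Δ.gp1 _).2 b₁₃.2) ((Δ.gp1 _).2 b₂₄.2))
    have e := P.eq_eps_mul_of_null hne (P.null_rotate hn)
    rw [← mul_assoc, P.eps_mul_eps, one_mul] at e
    exact Units.ext e.symm

/-- The homomorphism from the extended Tutte group given by a representation. -/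
noncomputable def tutteHom (Δ : M.Rep P) : M.TutteGroup →* (P : Type v)ˣ :=
  QuotientGroup.lift M.tutteRelations Δ.freeHom Δ.tutteRelations_le_ker

theorem tutteHom_eps (Δ : M.Rep P) : Δ.tutteHom M.tutteEps = P.epsUnit := Δ.freeHom_eps

theorem tutteHom_X (Δ : M.Rep P) (b : M.OrderedBase) : Δ.tutteHom (tutteX b) = Δ.unitAt b :=
  Δ.freeHom_X b

/-- The pasture morphism from the foundation given by a representation. -/
noncomputable def foundationHom (Δ : M.Rep P) : Hom M.foundation P :=
  ofTriplesLift (Δ.tutteHom.comp M.tutteDegree.ker.subtype)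
    (by
      change (Δ.tutteHom M.tutteEps : P) = _
      rw [tutteHom_eps]
      rfl)
    (by
      rintro t ⟨g, s, ⟨m, h, J, e₁, e₂, e₃, e₄, b₁₂, b₃₄, b₁₃, b₂₄, b₁₄, b₂₃, h₁₂, h₃₄, h₁₃, h₂₄,
        h₁₄, h₂₃, rfl⟩, ht⟩
      -- The factors of `s` need not have degree `0`, but `Δ.tutteHom` is defined on the whole Tutte
      -- group, so the triple is the image of a Plücker triple scaled by the image of `g`.
      have hn := P.null_mul (Δ.gp3 m h J e₁ e₂ e₃ e₄) (Δ.tutteHom g : P)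
      rw [← h₁₂, ← h₃₄, ← h₁₃, ← h₂₄, ← h₁₄, ← h₂₃] at hn
      convert hn using 1
      funext i
      change (Δ.tutteHom (t i : M.TutteGroup) : P) = _
      rw [ht i]
      fin_cases i
      · change (Δ.tutteHom (tutteX b₁₂ * tutteX b₃₄ * g) : P) = _
        simp only [map_mul, tutteHom_X]
        rfl
      · change (Δ.tutteHom (M.tutteEps * (tutteX b₁₃ * tutteX b₂₄) * g) : P) = _
        simp only [map_mul, tutteHom_X, tutteHom_eps]
        rfl
      · change (Δ.tutteHom (tutteX b₁₄ * tutteX b₂₃ * g) : P) = _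
        simp only [map_mul, tutteHom_X]
        rfl)

end Rep

end Matroid

/-! ### The three-term Grassmann–Plücker relation for forms of top degree -/

section GrassmannPluecker

variable {k V : Type*} [Field k] [AddCommGroup V] [Module k V] [FiniteDimensional k V]

/-- An independent family of full size is a basis, and a nonzero form of top degree cannot vanish on
a basis. -/
theorem AlternatingMap.ne_zero_iff_linearIndependent {ι : Type*} [Fintype ι]
    (hι : Fintype.card ι = Module.finrank k V) {f : V [⋀^ι]→ₗ[k] k} (hf : f ≠ 0) (v : ι → V) :
    f v ≠ 0 ↔ LinearIndependent k v := by
  refine ⟨fun h => ?_, fun h => ?_⟩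
  · by_contra hv
    exact h (f.map_linearDependent v hv)
  · have := (f.map_basis_ne_zero_iff (basisOfLinearIndependentOfCardEqFinrank' v h hι)).2 hf
    rwa [coe_basisOfLinearIndependentOfCardEqFinrank'] at this

/-- Fixing all arguments but the last two in an alternating form of top degree gives a
decomposable form. -/
theorem AlternatingMap.exists_append_eq {m : ℕ} (hV : Module.finrank k V = m + 2)
    (f : V [⋀^Fin (m + 2)]→ₗ[k] k) (J : Fin m → V) :
    ∃ (D : k) (α β : V → k), ∀ v v' : V,
      f (Fin.append J ![v, v']) = D * (α v * β v' - α v' * β v) := by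
  by_cases h0 : ∀ p q, f (Fin.append J ![p, q]) = 0
  · exact ⟨0, 0, 0, fun v v' => by simp [h0]⟩
  push Not at h0
  obtain ⟨p, q, hpq⟩ := h0
  have hli : LinearIndependent k (Fin.append J ![p, q]) := by
    by_contra hv
    exact hpq (f.map_linearDependent _ hv)
  -- A nonzero value completes `J` to a basis `c`. Then `α` and `β` are the last two coordinates in
  -- `c`, and `D` is the value of `f` on `c`.
  set c := basisOfLinearIndependentOfCardEqFinrank' (Fin.append J ![p, q]) hli (by simp [hV])
    with hc
  have hcJ : ∀ i, c (Fin.castAdd 2 i) = J i := fun i => by simp [hc]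
  refine ⟨f c, fun v => c.repr v (Fin.natAdd m 0), fun v => c.repr v (Fin.natAdd m 1),
    fun v v' => ?_⟩
  conv_lhs => rw [f.eq_smul_basis_det c]
  rw [AlternatingMap.smul_apply, smul_eq_mul, Module.Basis.det_apply,
    ← Matrix.det_submatrix_equiv_self finSumFinEquiv]
  congr 1
  -- The vectors of `J` are the first `m` basis vectors, so the matrix is block upper triangular
  -- with an identity block. Only the `2 × 2` minor of last coordinates survives.
  have hblock : (c.toMatrix (Fin.append J ![v, v'])).submatrix finSumFinEquiv finSumFinEquiv =
      Matrix.fromBlocks 1 (Matrix.of fun i j => c.repr (![v, v'] j) (Fin.castAdd 2 i)) 0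
        (Matrix.of fun i j => c.repr (![v, v'] j) (Fin.natAdd m i)) := by
    ext i j
    rcases i with i | i <;> rcases j with j | j
    · simp [Module.Basis.toMatrix_apply, ← hcJ, Finsupp.single_apply, Matrix.one_apply, eq_comm]
    · simp [Module.Basis.toMatrix_apply]
    · have : Fin.castAdd 2 j ≠ Fin.natAdd m i := fun h => by
        have := congrArg Fin.val h
        simp at this
        omega
      simp [Module.Basis.toMatrix_apply, ← hcJ, this]
    · simp [Module.Basis.toMatrix_apply]
  rw [hblock, Matrix.det_fromBlocks_zero₂₁, Matrix.det_one, one_mul, Matrix.det_fin_two]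
  simp

/-- The three-term Grassmann–Plücker relation. -/
theorem AlternatingMap.grassmann_pluecker {m r : ℕ} (h : m + 2 = r)
    (hV : Module.finrank k V = r) (f : V [⋀^Fin r]→ₗ[k] k) (J : Fin m → V) (e₁ e₂ e₃ e₄ : V) :
    let g : V → V → k := fun a b => f fun i => Fin.append J ![a, b] (Fin.cast h.symm i)
    g e₁ e₂ * g e₃ e₄ + -1 * (g e₁ e₃ * g e₂ e₄) + g e₁ e₄ * g e₂ e₃ = 0 := by
  subst h
  obtain ⟨D, α, β, hD⟩ := f.exists_append_eq hV J
  -- What remains is the polynomial identity among the `2 × 2` minors of a `2 × 4` matrix.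
  simp only [Fin.cast_eq_self, hD]
  ring

end GrassmannPluecker

/-! ### Column matroids are representable -/

namespace Matroid

open Pasture

variable {α : Type u} {M : Matroid α} {k : Type v} [Field k]

/-- A count of elements: a tuple of length `r` enumerating a basis has no repetitions, and an
independent set of `r` elements fills any basis containing it. -/
theorem isBaseTuple_iff_linearIndependent [M.Finite] {W : Type*} [AddCommGroup W] [Module k W]
    {A : α → W} (hA : ∀ I ⊆ M.E, M.Indep I ↔ LinearIndepOn k A I) (x : M.Tuple) :
    M.IsBaseTuple x ↔ LinearIndependent k fun i => A (x i) := by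
  have hsub : (Set.range fun i => (x i : α)) ⊆ M.E := by
    rintro _ ⟨i, rfl⟩
    exact (x i).2
  have hr : (M.rk' : ℕ∞) = M.eRank := ENat.natCast_toNat (M.eRank_ne_top_iff.2 inferInstance)
  refine ⟨fun h => ?_, fun h => ?_⟩
  · have hinj : Function.Injective fun i => (x i : α) := by
      have h1 := h.encard_eq_eRank
      rw [← hr, ← Set.image_univ] at h1
      have h2 := Set.finite_univ.injOn_of_encard_image_eq (f := fun i => (x i : α))
        (by rw [h1]; simp)
      exact Set.injOn_univ.1 h2
    exact (linearIndepOn_range_iff hinj A).1 ((hA _ hsub).1 h.indep)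
  · have hinj : Function.Injective fun i => (x i : α) := fun i j hij =>
      h.injective (congrArg A hij)
    have hI : M.Indep (Set.range fun i => (x i : α)) :=
      (hA _ hsub).2 ((linearIndepOn_range_iff hinj A).2 h)
    obtain ⟨B, hB, hIB⟩ := hI.exists_isBase_superset
    have hcard : (Set.range fun i => (x i : α)).encard = M.rk' := by
      rw [← Set.image_univ, hinj.encard_image]
      simp
    have e := (hB.finite.subset hIB).eq_of_subset_of_encard_le hIB
      (by rw [hB.encard_eq_eRank, hcard, hr])
    rw [IsBaseTuple, e]
    exact hB

theorem finrank_span_eq_rk' [M.Finite] {W : Type*} [AddCommGroup W] [Module k W]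
    {A : α → W} (hA : ∀ I ⊆ M.E, M.Indep I ↔ LinearIndepOn k A I) :
    Module.finrank k (Submodule.span k (A '' M.E)) = M.rk' := by
  obtain ⟨B, hB⟩ := M.exists_isBase
  have hspan : Submodule.span k (A '' M.E) = Submodule.span k (Set.range fun i : B => A i) := by
    rw [← Set.image_eq_range]
    refine le_antisymm (Submodule.span_le.2 ?_)
      (Submodule.span_mono (Set.image_mono hB.subset_ground))
    rintro _ ⟨e, he, rfl⟩
    -- A column outside the span of the columns of `B` would enlarge the basis `B` to an independent
    -- set.
    by_contra hne
    have hi := ((hA B hB.subset_ground).1 hB.indep).insert hne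
    have heB : e ∉ B := fun h => hne (Submodule.subset_span ⟨e, h, rfl⟩)
    exact (hB.insert_dep ⟨he, heB⟩).not_indep
      ((hA _ (Set.insert_subset he hB.subset_ground)).2 hi)
  have := hB.finite.fintype
  rw [hspan, finrank_span_eq_card ((hA B hB.subset_ground).1 hB.indep), rk',
    ← hB.encard_eq_eRank, ← Set.ncard_def, ← Nat.card_coe_set_eq,
    Nat.card_eq_fintype_card]

/-- The matroid of the columns of a matrix is represented by the maximal minors. -/
theorem IsVectorMatroidOver.representableOver [M.Finite] (h : M.IsVectorMatroidOver k) :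
    M.RepresentableOver (ofField k) := by
  obtain ⟨n, A, hA⟩ := h
  have hr := finrank_span_eq_rk' hA
  -- The matrix may have more rows than the rank. Inside the column span the dimension is exactly
  -- the rank, so a determinant form takes the place of maximal minors.
  set V := Submodule.span k (A '' M.E) with hV
  let a : M.E → V := fun e => ⟨A e, Submodule.subset_span ⟨e, e.2, rfl⟩⟩
  let f : V [⋀^Fin M.rk']→ₗ[k] k := (Module.finBasisOfFinrankEq k V hr).det
  have hf : f ≠ 0 := Module.Basis.det_ne_zero _
  refine ⟨⟨fun x => f fun i => a (x i), fun x => ?_, fun x σ => ?_, fun m h J e₁ e₂ e₃ e₄ => ?_⟩⟩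
  · rw [isBaseTuple_iff_linearIndependent hA]
    refine (f.ne_zero_iff_linearIndependent (by simp [hr]) hf _).trans ?_
    exact (V.subtype.linearIndependent_iff (V.ker_subtype)).symm
  · have hσ := f.map_perm (fun i => a (x i)) σ
    refine hσ.trans ?_
    change _ = (signPow (-1 : k) σ) * f _
    unfold signPow
    rcases Int.units_eq_one_or (Equiv.Perm.sign σ) with hs | hs <;> simp [hs]
  · have gp := f.grassmann_pluecker h hr (fun i => a (J i)) (a e₁) (a e₂) (a e₃) (a e₄)
    have ht : ∀ p q, (fun i => a (M.tup h J p q i)) =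
        fun i => Fin.append (fun i => a (J i)) ![a p, a q] (Fin.cast h.symm i) := by
      intro p q
      funext i
      unfold tup
      generalize Fin.cast h.symm i = j
      refine Fin.addCases (fun j => ?_) (fun j => ?_) j
      · simp
      · fin_cases j <;> simp
    simp only [ht]
    exact gp

end Matroid
-- Assembly
theorem mainTheorem4 :
    (∀ (k : Type u) [Field k], IsEmpty (Pasture.Hom Pasture.P0 (Pasture.ofField k))) ∧
    (∀ (α : Type v) (M : Matroid α) [M.Finite],
      Nonempty (Pasture.Hom Pasture.P0 M.foundation) →
        ∀ (k : Type u) [Field k],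
          ¬ M.RepresentableOver (Pasture.ofField k) ∧ ¬ M.IsVectorMatroidOver k) ∧
    (∀ (α : Type v) (M : Matroid α) [M.Finite] (F : Pasture.{w}),
      Matroid.IsFoundation.{v, u, w} M F → Nonempty (Pasture.Hom Pasture.P0 F) →
        ∀ (k : Type u) [Field k],
          ¬ M.RepresentableOver (Pasture.ofField k) ∧ ¬ M.IsVectorMatroidOver k) ∧
    (∀ P : Pasture.{u}, P.IsFundamental 1 → Nonempty (Pasture.Hom Pasture.P0 P)) ∧
    (∀ (P : Pasture.{u}) (a : P), P.IsFundamentalPair a 1 →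
      ∃ f : Pasture.Hom Pasture.P0 P,
        f (Pasture.P0.gen 0) = a ∧ f (Pasture.P0.gen 1) = 1 ∧
        f (Pasture.P0.gen 2) = 1 ∧ f (Pasture.P0.gen 3) = a) := by
  have aux : ∀ (α : Type v) (M : Matroid α) [M.Finite] (k : Type u) [Field k],
      ¬ M.RepresentableOver (Pasture.ofField k) →
        ¬ M.RepresentableOver (Pasture.ofField k) ∧ ¬ M.IsVectorMatroidOver k :=
    fun α M _ k _ h => ⟨h, fun hv => h hv.representableOver⟩
  refine ⟨Pasture.isEmpty_hom_P0_ofField, ?_, ?_, ?_, Pasture.exists_hom_P0⟩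
  · rintro α M _ ⟨f⟩ k _
    refine aux α M k ?_
    rintro ⟨Δ⟩
    exact (Pasture.isEmpty_hom_P0_ofField k).false (Δ.foundationHom.comp f)
  · rintro α M _ F ⟨e, -⟩ ⟨f⟩ k _
    refine aux α M k ?_
    rintro ⟨Δ⟩
    -- The bijection `e` at the field turns the rescaling class of `Δ` into a morphism from `F` to
    -- `k`.
    exact (Pasture.isEmpty_hom_P0_ofField k).false ((e _ (Quotient.mk _ Δ)).comp f)
  · rintro P ⟨y, h1, hy, hn⟩
    obtain ⟨f, -⟩ := Pasture.exists_hom_P0 P y ⟨hy, h1, P.null_swap hn⟩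
    exact ⟨f⟩
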